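/- Let $X$ be a compact connected (Hausdorff) complex manifold of dimension $k$. A holomorphic correspondence $F$ on $X$ is a nonempty finite formal sum $\Gamma=\sum_{j=1}^N m_j\Gamma_j$ with $m_j$ positive integers and $\Gamma_j\subseteq X\times X$ distinct irreducible complex subvarieties of dimension $k$, each projecting onto both factors, such that for every $z\in X$ the sets $\bigcup_j\{w:(z,w)\in\Gamma_j\}$ and $F^\dagger(z)=\bigcup_j\{w:(w,z)\in\Gamma_j\}$ are finite. The points of $F^\dagger(z)$ are counted with multiplicity: $w$ is counted $\sum_j m_j\,\nu_j(w,z)$ times, where $\nu_j(w,z)$ is the number of points $w'$ near $w$ with $(w',z')\in\Gamma_j$, for $z'$ generic near $z$; sums with this convention are written $\sum'$. The topological degree $d$ of $F$ is the number $\sum_j m_j\,\#\{w:(w,z)\in\Gamma_j\}$ for generic $z\in X$. A Borel probability measure $\mu$ on $X$ is $F^*$ invariant if $$\int_X \sum_{w\in F^\dagger(z)}{}^{'}\ \phi(w)\,d\mu(z)=d\int_X\phi\,d\mu\qquad\text{for all }\phi\in\mathcal C(X,\mathbb R).$$ Put $(U_F\phi)(z)=\frac1d\sum'_{w\in F^\dagger(z)}\phi(w)$,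 $I_n^F(\phi,\psi)=\int_X (U_F^n\phi)\,\psi\,d\mu$ and $I(\phi)=\int_X\phi\,d\mu$. $F$ is weakly mixing with respect to $\mu$ if $$\lim_{n\to\infty}\frac1n\sum_{j=0}^{n-1}\left|I_j^F(\phi,\psi)-I(\phi)I(\psi)\right|=0\qquad\text{for all }\phi\in\mathcal C(X,\mathbb R),\ \psi\in L^1(\mu).$$ Let $F^\times=F\times F$ be the product correspondence on $X\times X$, i.e. the formal sum $\sum_{i,j}m_im_j\{((z_1,z_2),(w_1,w_2)):(z_1,w_1)\in\Gamma_i,\ (z_2,w_2)\in\Gamma_j\}$. The degree, the operator $U_{F^\times}$, the correlations $I_n^{F^\times}$ and weak mixing of $F^\times$ are defined in the same way, with $X\times X$ and $\mu\times\mu$ in place of $X$ and $\mu$. Lemma. Let $F$ be a holomorphic correspondence on $X$ and $\mu$ an $F^*$ invariant Borel probability measure on $X$. Then $F^\times$ is weakly mixing with respect to $\mu\times\mu$ if and only if, for every $\phi$ of the form $\phi(x_1,x_2)=\phi_1(x_1)\phi_2(x_2)$ with $\phi_1,\phi_2\in\mathcal C(X,\mathbb R)$ and every $\psi=\chi_{B_1\times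 B_2}$ with $B_1,B_2\subseteq X$ Borel, $$\lim_{n\to\infty}\frac1n\sum_{j=0}^{n-1}\left|I_j^{F^\times}(\phi,\psi)-I(\phi)I(\psi)\right|=0,$$ where $I(\cdot)$ now denotes integration over $X\times X$ with respect to $\mu\times\mu$. -/

import Mathlib

open Set Filter Topology MeasureTheory
open scoped Manifold ContDiff

noncomputable section

namespace HolCorr

/-! ### Complex analytic subvarieties of a complex manifold -/

section Analytic

variable {E : Type*} [NormedAddCommGroup E] [NormedSpace ℂ E]
  {H : Type*} [TopologicalSpace H] (I : ModelWithCorners ℂ E H)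
  {M : Type*} [TopologicalSpace M] [ChartedSpace H M]

/-- `A` is a complex analytic subset (complex subvariety) of `M`: near every point of `M` it is the
common zero set of finitely many holomorphic functions. -/
def IsAnalyticSubset (A : Set M) : Prop :=
  ∀ p : M, ∃ U : Set M, IsOpen U ∧ p ∈ U ∧ ∃ (r : ℕ) (f : Fin r → M → ℂ),
    (∀ i, MDifferentiableOn I 𝓘(ℂ, ℂ) (f i) U) ∧ A ∩ U = {x ∈ U | ∀ i, f i x = 0}

/-- `A` is irreducible: nonempty, and not a union of two proper analytic subsets. -/
def IsIrreducibleAnalytic (A : Set M) : Prop :=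
  A.Nonempty ∧ ∀ A₁ A₂ : Set M, IsAnalyticSubset I A₁ → IsAnalyticSubset I A₂ →
    A = A₁ ∪ A₂ → A₁ = A ∨ A₂ = A

/-- `p` is a regular point of `A`, of dimension `m`: some holomorphic chart of `M` at `p` maps `A`
onto (a relatively open piece of) an affine complex subspace of dimension `m`. -/
def IsRegularPoint (A : Set M) (m : ℕ) (p : M) : Prop :=
  p ∈ A ∧ ∃ e ∈ IsManifold.maximalAtlas I ω M, p ∈ e.source ∧
    ∃ L : Submodule ℂ E, Module.finrank ℂ L = m ∧
      ∀ x ∈ e.source, (x ∈ A ↔ e.extend I x - e.extend I p ∈ L)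

/-- The dimension of `A` (the largest dimension at a regular point) is `m`. -/
def HasDimension (A : Set M) (m : ℕ) : Prop :=
  (∃ p, IsRegularPoint I A m p) ∧ ∀ (l : ℕ) (p : M), IsRegularPoint I A l p → l ≤ m

end Analytic

/-! ### Holomorphic correspondences -/

/-- A formal sum `∑ j, m j • Γ j` of subsets `Γ j` of `X × X` with natural number coefficients.
A point `(z, w)` of `Γ j` is read as "`w` is an image of `z`". -/
structure CorrCycle (X : Type*) where
  /-- the finite index set of the sum -/
  index : Type
  /-- the index set is finite -/
  fintypeIndex : Fintype index
  /-- the coefficients -/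
  coeff : index → ℕ
  /-- the components -/
  comp : index → Set (X × X)

attribute [instance] CorrCycle.fintypeIndex

/-- The cycle `F` is a holomorphic correspondence on the complex manifold `X`: a nonempty formal sum,
with positive coefficients, of distinct irreducible subvarieties of `X × X` of dimension `dim X`,
each of which projects onto both factors, such that all points have finitely many images and
preimages. -/
structure IsHolomorphicCorrespondence {E : Type*} [NormedAddCommGroup E] [NormedSpace ℂ E]
    {H : Type*} [TopologicalSpace H] (I : ModelWithCorners ℂ E H)
    {X : Type*} [TopologicalSpace X] [ChartedSpace H X] (F : CorrCycle X) : Prop where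
  nonempty : Nonempty F.index
  coeff_pos : ∀ j, 0 < F.coeff j
  injective : Function.Injective F.comp
  analytic : ∀ j, IsAnalyticSubset (I.prod I) (F.comp j)
  irreducible : ∀ j, IsIrreducibleAnalytic (I.prod I) (F.comp j)
  dimension : ∀ j, HasDimension (I.prod I) (F.comp j) (Module.finrank ℂ E)
  fst_surj : ∀ j, Prod.fst '' F.comp j = univ
  snd_surj : ∀ j, Prod.snd '' F.comp j = univ
  finite_images : ∀ z, (⋃ j, {w | (z, w) ∈ F.comp j}).Finite
  finite_preimages : ∀ z, (⋃ j, {w | (w, z) ∈ F.comp j}).Finite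

/-- The product `F₁ × F₂`, a cycle on `X₁ × X₂`: its components are the sets
`{((z₁, z₂), (w₁, w₂)) | (z₁, w₁) ∈ Γ¹ i, (z₂, w₂) ∈ Γ² j}`, with the products of the coefficients. -/
def CorrCycle.prod {X₁ X₂ : Type*} (F₁ : CorrCycle X₁) (F₂ : CorrCycle X₂) : CorrCycle (X₁ × X₂) where
  index := F₁.index × F₂.index
  fintypeIndex := inferInstance
  coeff := fun ij => F₁.coeff ij.1 * F₂.coeff ij.2
  comp := fun ij =>
    {p | (p.1.1, p.2.1) ∈ F₁.comp ij.1 ∧ (p.1.2, p.2.2) ∈ F₂.comp ij.2}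

section Dynamics

variable {X : Type*} [TopologicalSpace X]

/-- The number of preimages of `z`, each component being counted with its coefficient. -/
def CorrCycle.preimageCard (F : CorrCycle X) (z : X) : ℕ :=
  ∑ j, F.coeff j * {w | (w, z) ∈ F.comp j}.ncard

/-- The topological degree: the number of preimages of a generic point, that is, the value of
`preimageCard` on some dense open set (two dense open sets meet, so there is only one such value). -/
def CorrCycle.topDegree (F : CorrCycle X) : ℕ :=
  sInf {d | ∃ G : Set X, IsOpen G ∧ Dense G ∧ ∀ z ∈ G, F.preimageCard z = d}

/-- The multiplicity of `w` as a preimage of `z` under `Γ ⊆ X × X`, i.e. the local degree at `(w, z)`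
of the second projection restricted to `Γ`: the number of preimages, in a small neighbourhood `V` of
`w`, of a generic point `z'` of a small neighbourhood `W` of `z`. It is `0` if `(w, z)` is not in the
closure of `Γ`. -/
def localMult (Γ : Set (X × X)) (w z : X) : ℕ :=
  sInf {n | ∃ V ∈ 𝓝 w, ∃ W ∈ 𝓝 z, ∃ G : Set X, IsOpen G ∧ Dense G ∧
    ∀ z' ∈ W ∩ G, {w' ∈ V | (w', z') ∈ Γ}.encard ≤ n}

/-- The sum of `φ w` over the preimages `w` of `z`, repeated according to multiplicity. -/
def CorrCycle.preimageSum (F : CorrCycle X) (φ : X → ℝ) (z : X) : ℝ :=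
  ∑ j, (F.coeff j : ℝ) * ∑ᶠ w, (localMult (F.comp j) w z : ℝ) * φ w

/-- The Koopman operator `U_F`. -/
def CorrCycle.koopman (F : CorrCycle X) (φ : X → ℝ) (z : X) : ℝ :=
  1 / (F.topDegree : ℝ) * F.preimageSum φ z

variable [MeasurableSpace X]

/-- `μ` is `F^*` invariant: `F^* μ = d μ`, as functionals on the continuous functions. -/
def CorrCycle.IsPullbackInvariant (F : CorrCycle X) (μ : Measure X) : Prop :=
  ∀ φ : C(X, ℝ), ∫ z, F.preimageSum φ z ∂μ = (F.topDegree : ℝ) * ∫ z, φ z ∂μ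

/-- The correlation `I_n^F(φ, ψ) = ∫ (U_F^n φ) ψ dμ`. -/
def CorrCycle.correlation (F : CorrCycle X) (μ : Measure X) (n : ℕ) (φ ψ : X → ℝ) : ℝ :=
  ∫ z, (F.koopman^[n] φ) z * ψ z ∂μ

/-- `F` is weakly mixing with respect to `μ`. -/
def CorrCycle.WeaklyMixing (F : CorrCycle X) (μ : Measure X) : Prop :=
  ∀ (φ : C(X, ℝ)) (ψ : X → ℝ), Integrable ψ μ →
    Tendsto (fun n : ℕ => 1 / (n : ℝ) * ∑ j ∈ Finset.range n,
      |F.correlation μ j φ ψ - (∫ z, φ z ∂μ) * ∫ z, ψ z ∂μ|) atTop (𝓝 0)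

end Dynamics

/-- The continuous functions on `X × X` of the form `(x₁, x₂) ↦ φ₁ x₁ * φ₂ x₂`, with `φ₁`, `φ₂`
continuous. -/
def P₁ (X : Type*) [TopologicalSpace X] : Set C(X × X, ℝ) :=
  {φ | ∃ φ₁ φ₂ : C(X, ℝ), ∀ x : X × X, φ x = φ₁ x.1 * φ₂ x.2}

/-- The indicator functions of `B₁ × B₂`, with `B₁`, `B₂` measurable. -/
def P₂ (X : Type*) [MeasurableSpace X] : Set (X × X → ℝ) :=
  {ψ | ∃ B₁ B₂ : Set X, MeasurableSet B₁ ∧ MeasurableSet B₂ ∧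
    ψ = (B₁ ×ˢ B₂).indicator (fun _ => (1 : ℝ))}

end HolCorr

end

/-! One direction is a specialisation, since indicators of rectangles are integrable. The converse
is a density argument, and its engine is a contraction property: almost everywhere, the iterates of
the Koopman operator do not increase the sup norm of a continuous function
(`CorrCycle.IsKoopmanContraction`). The deviations `I_j(φ, ψ) - I(φ) I(ψ)` are then bilinear and
bounded by `2 ‖φ‖ ‖ψ‖₁` uniformly in `j`, so Cesàro nullity passes to spans and limits in either
variable. For a fixed rectangle, Stone–Weierstrass extends the hypothesis from `P₁ X` to all
continuous `φ`; for fixed `φ`, a π-λ argument and density of simple functions in `L¹` extend it to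
all integrable `ψ`.

The contraction comes from invariance. Counted with multiplicity, each point has at least `d`
preimages (`CorrCycle.topDegree_le_sum_localMult`); testing invariance on the constant `1` shows
that the mean is `d`, so almost every point has exactly `d`. The weighted preimages therefore form,
off a null set, a Markov kernel preserving `μ`. Local multiplicities and degrees multiply under
products (`localMult_relProd`, `CorrCycle.topDegree_prod_self`), so `F × F` acts as the parallel
product of this kernel with itself, which preserves `μ × μ`. If the degree of `F × F` is `0`,
including as the default value of `sInf`, all positive iterates vanish and the contraction is
trivial; a generic degree thus never has to be shown to exist. -/

namespace HolCorr

/-! ### Analytic subsets are closed -/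

theorem IsAnalyticSubset.isClosed {E : Type*} [NormedAddCommGroup E] [NormedSpace ℂ E]
    {H : Type*} [TopologicalSpace H] {I : ModelWithCorners ℂ E H}
    {M : Type*} [TopologicalSpace M] [ChartedSpace H M] {A : Set M}
    (hA : IsAnalyticSubset I A) : IsClosed A := by
  rw [← isOpen_compl_iff, isOpen_iff_mem_nhds]
  intro p hp
  obtain ⟨U, hU, hpU, r, f, hf, hAU⟩ := hA p
  have hne : ∃ i, f i p ≠ 0 := by
    by_contra! h
    exact hp (hAU.symm.subset ⟨hpU, h⟩ : p ∈ A ∩ U).1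
  obtain ⟨i, hi⟩ := hne
  have hc : ContinuousAt (f i) p := (hf i).continuousOn.continuousAt (hU.mem_nhds hpU)
  filter_upwards [hU.mem_nhds hpU, hc.eventually_ne hi] with x hxU hx hxA
  exact hx ((hAU.subset ⟨hxA, hxU⟩).2 i)

/-! ### Multiplicities -/

section Multiplicity

variable {X : Type*} [TopologicalSpace X]

/-- `n` is a bound for the number of preimages near `w` of generic points near `z`. -/
def IsLocalBound (Γ : Set (X × X)) (w z : X) (n : ℕ) : Prop :=
  ∃ V ∈ 𝓝 w, ∃ W ∈ 𝓝 z, ∃ G : Set X, IsOpen G ∧ Dense G ∧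
    ∀ z' ∈ W ∩ G, {w' ∈ V | (w', z') ∈ Γ}.encard ≤ n

theorem localMult_eq (Γ : Set (X × X)) (w z : X) :
    localMult Γ w z = sInf {n | IsLocalBound Γ w z n} := rfl

theorem IsLocalBound.localMult {Γ : Set (X × X)} {w z : X} {n : ℕ} (h : IsLocalBound Γ w z n) :
    IsLocalBound Γ w z (localMult Γ w z) :=
  Nat.sInf_mem (s := {n | IsLocalBound Γ w z n}) ⟨n, h⟩

theorem IsLocalBound.localMult_le {Γ : Set (X × X)} {w z : X} {n : ℕ}
    (h : IsLocalBound Γ w z n) : HolCorr.localMult Γ w z ≤ n :=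
  Nat.sInf_le (s := {n | IsLocalBound Γ w z n}) h

/-- The infimum of the empty set of naturals is `0`. -/
theorem localMult_eq_zero_of_not_exists {Γ : Set (X × X)} {w z : X}
    (h : ¬ ∃ n, IsLocalBound Γ w z n) : localMult Γ w z = 0 := by
  rw [localMult_eq, Nat.sInf_eq_zero]
  exact Or.inr (eq_empty_of_forall_notMem fun n hb => h ⟨n, hb⟩)

theorem not_isLocalBound_of_lt {Γ : Set (X × X)} {w z : X} {n : ℕ}
    (h : n < localMult Γ w z) : ¬ IsLocalBound Γ w z n :=
  fun hb => h.not_ge hb.localMult_le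

theorem localMult_eq_zero_of_notMem {Γ : Set (X × X)} (hΓ : IsClosed Γ) {w z : X}
    (h : (w, z) ∉ Γ) : localMult Γ w z = 0 := by
  have hn : Γᶜ ∈ 𝓝 (w, z) := hΓ.isOpen_compl.mem_nhds h
  rw [nhds_prod_eq, mem_prod_iff] at hn
  obtain ⟨V, hV, W, hW, hVW⟩ := hn
  refine Nat.le_zero.1 (IsLocalBound.localMult_le
    ⟨V, hV, W, hW, univ, isOpen_univ, dense_univ, fun z' hz' => ?_⟩)
  have : {w' ∈ V | (w', z') ∈ Γ} = ∅ :=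
    eq_empty_of_forall_notMem fun w' hw' => hVW (mk_mem_prod hw'.1 hz'.1) hw'.2
  simp [this]

variable {Y : Type*} [TopologicalSpace Y]

/-- The product of two relations, as a relation on the product space. -/
def relProd (Γ : Set (X × X)) (Δ : Set (Y × Y)) : Set ((X × Y) × (X × Y)) :=
  {p | (p.1.1, p.2.1) ∈ Γ ∧ (p.1.2, p.2.2) ∈ Δ}

theorem encard_sep_relProd {X Y : Type*} (Γ : Set (X × X)) (Δ : Set (Y × Y)) (V : Set X)
    (V' : Set Y) (z : X × Y) :
    {w ∈ V ×ˢ V' | (w, z) ∈ relProd Γ Δ}.encard =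
      {w ∈ V | (w, z.1) ∈ Γ}.encard * {w ∈ V' | (w, z.2) ∈ Δ}.encard := by
  rw [← encard_prod]
  congr 1
  ext w
  simp only [relProd, mem_ofPred_eq, mem_prod]
  tauto

theorem IsLocalBound.prod {Γ : Set (X × X)} {Δ : Set (Y × Y)} {w z : X} {w' z' : Y} {m n : ℕ}
    (h : IsLocalBound Γ w z m) (h' : IsLocalBound Δ w' z' n) :
    IsLocalBound (relProd Γ Δ) (w, w') (z, z') (m * n) := by
  obtain ⟨V, hV, W, hW, G, hG, hGd, hb⟩ := h
  obtain ⟨V', hV', W', hW', G', hG', hGd', hb'⟩ := h'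
  refine ⟨V ×ˢ V', prod_mem_nhds hV hV', W ×ˢ W', prod_mem_nhds hW hW', G ×ˢ G', hG.prod hG',
    hGd.prod hGd', ?_⟩
  rintro ⟨a, b⟩ ⟨⟨ha, hb₀⟩, ha', hb₀'⟩
  rw [encard_sep_relProd, Nat.cast_mul]
  exact mul_le_mul' (hb a ⟨ha, ha'⟩) (hb' b ⟨hb₀, hb₀'⟩)

/-- Empty fibres in one factor suffice, even when the fibres of the other are infinite, because `0 *
⊤ = 0` in `ℕ∞`. `IsLocalBound.prod` does not cover this case, as it wants a finite bound on both
sides. -/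
theorem IsLocalBound.prod_zero_left {Γ : Set (X × X)} (Δ : Set (Y × Y)) {w z : X}
    (h : IsLocalBound Γ w z 0) (w' z' : Y) :
    IsLocalBound (relProd Γ Δ) (w, w') (z, z') 0 := by
  obtain ⟨V, hV, W, hW, G, hG, hGd, hb⟩ := h
  refine ⟨V ×ˢ univ, prod_mem_nhds hV univ_mem, W ×ˢ univ, prod_mem_nhds hW univ_mem,
    G ×ˢ univ, hG.prod isOpen_univ, hGd.prod dense_univ, ?_⟩
  rintro ⟨a, b⟩ ⟨⟨ha, -⟩, ha', -⟩
  rw [encard_sep_relProd, nonpos_iff_eq_zero.1 (hb a ⟨ha, ha'⟩), zero_mul,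
    Nat.cast_zero]

theorem IsLocalBound.prod_zero_right (Γ : Set (X × X)) {Δ : Set (Y × Y)} {w' z' : Y}
    (h : IsLocalBound Δ w' z' 0) (w z : X) :
    IsLocalBound (relProd Γ Δ) (w, w') (z, z') 0 := by
  obtain ⟨V, hV, W, hW, G, hG, hGd, hb⟩ := h
  refine ⟨univ ×ˢ V, prod_mem_nhds univ_mem hV, univ ×ˢ W, prod_mem_nhds univ_mem hW,
    univ ×ˢ G, isOpen_univ.prod hG, dense_univ.prod hGd, ?_⟩
  rintro ⟨a, b⟩ ⟨⟨-, ha⟩, -, ha'⟩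
  rw [encard_sep_relProd, nonpos_iff_eq_zero.1 (hb b ⟨ha, ha'⟩), mul_zero,
    Nat.cast_zero]

/-- If `m` is no local bound, the points with more than `m` preimages are somewhere dense. -/
theorem interior_closure_nonempty_of_not_isLocalBound {Γ : Set (X × X)} {w z : X} {m : ℕ}
    (h : ¬ IsLocalBound Γ w z m) {V : Set X} (hV : V ∈ 𝓝 w) {W : Set X} (hW : W ∈ 𝓝 z) :
    (interior (closure {z' ∈ W | (m : ℕ∞) < {w' ∈ V | (w', z') ∈ Γ}.encard})).Nonempty := by
  by_contra hne
  rw [not_nonempty_iff_eq_empty, interior_eq_empty_iff_dense_compl] at hne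
  refine h ⟨V, hV, W, hW, _, isClosed_closure.isOpen_compl, hne, fun z' hz' => ?_⟩
  by_contra hlt
  exact hz'.2 (subset_closure ⟨hz'.1, not_le.1 hlt⟩)

/-- The points with more than `m`, respectively `m'`, nearby preimages are dense in some nonempty
open sets. The product of these open sets meets the generic set `G`, and since `G` is open, it
contains a pair of such points; the fibre over that pair is large. -/
theorem succ_mul_succ_le_of_isLocalBound_prod {Γ : Set (X × X)} {Δ : Set (Y × Y)} {w z : X}
    {w' z' : Y} {m m' n : ℕ} (h : ¬ IsLocalBound Γ w z m) (h' : ¬ IsLocalBound Δ w' z' m')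
    (hn : IsLocalBound (relProd Γ Δ) (w, w') (z, z') n) : (m + 1) * (m' + 1) ≤ n := by
  obtain ⟨V, hV, W, hW, G, hG, hGd, hb⟩ := hn
  rw [nhds_prod_eq, mem_prod_iff] at hV hW
  obtain ⟨V₁, hV₁, V₂, hV₂, hV⟩ := hV
  obtain ⟨W₁, hW₁, W₂, hW₂, hW⟩ := hW
  have h₁ := interior_closure_nonempty_of_not_isLocalBound h hV₁ hW₁
  have h₂ := interior_closure_nonempty_of_not_isLocalBound h' hV₂ hW₂
  set A := {z' ∈ W₁ | (m : ℕ∞) < {w' ∈ V₁ | (w', z') ∈ Γ}.encard}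
  set B := {z' ∈ W₂ | (m' : ℕ∞) < {w' ∈ V₂ | (w', z') ∈ Δ}.encard}
  obtain ⟨p, hp, hpG⟩ := hGd.inter_open_nonempty _ (isOpen_interior.prod isOpen_interior)
    (h₁.prod h₂)
  have hp' : p ∈ closure (A ×ˢ B) := by
    rw [closure_prod_eq]
    exact ⟨interior_subset hp.1, interior_subset hp.2⟩
  obtain ⟨q, hqG, hqA, hqB⟩ := mem_closure_iff.1 hp' G hG hpG
  have hq := hb q ⟨hW ⟨hqA.1, hqB.1⟩, hqG⟩
  have hsub : {w ∈ V₁ ×ˢ V₂ | (w, q) ∈ relProd Γ Δ} ⊆ {w ∈ V | (w, q) ∈ relProd Γ Δ} :=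
    fun w hw => ⟨hV hw.1, hw.2⟩
  have hle := (encard_le_encard hsub).trans hq
  rw [encard_sep_relProd] at hle
  have := (mul_le_mul' (Order.add_one_le_of_lt hqA.2) (Order.add_one_le_of_lt hqB.2)).trans hle
  exact_mod_cast this

/-- Optimal bounds multiply to a bound; conversely, one less than each optimal bound fails, so the
preceding inequality makes every bound of the product at least the product of the optima. The
remaining cases deal with the default value `0`. -/
theorem localMult_relProd (Γ : Set (X × X)) (Δ : Set (Y × Y)) (w z : X) (w' z' : Y) :
    localMult (relProd Γ Δ) (w, w') (z, z') = localMult Γ w z * localMult Δ w' z' := by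
  by_cases hP : ∃ n, IsLocalBound (relProd Γ Δ) (w, w') (z, z') n
  swap
  · rw [localMult_eq_zero_of_not_exists hP]
    by_cases h : ∃ m, IsLocalBound Γ w z m
    · by_cases h' : ∃ m, IsLocalBound Δ w' z' m
      · exact absurd ⟨_, h.choose_spec.prod h'.choose_spec⟩ hP
      · rw [localMult_eq_zero_of_not_exists h', mul_zero]
    · rw [localMult_eq_zero_of_not_exists h, zero_mul]
  obtain ⟨n, hn⟩ := hP
  by_cases h0 : IsLocalBound Γ w z 0
  · rw [Nat.le_zero.1 h0.localMult_le, Nat.le_zero.1 (h0.prod_zero_left Δ w' z').localMult_le,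
      zero_mul]
  by_cases h0' : IsLocalBound Δ w' z' 0
  · rw [Nat.le_zero.1 h0'.localMult_le, Nat.le_zero.1 (h0'.prod_zero_right Γ w z).localMult_le,
      mul_zero]
  -- If `n` fails for `Γ` while `0` fails for `Δ`, then `(n + 1) * 1 ≤ n`.
  have hb : IsLocalBound Γ w z n := by
    by_contra hb
    have := succ_mul_succ_le_of_isLocalBound_prod hb h0' hn
    omega
  have hb' : IsLocalBound Δ w' z' n := by
    by_contra hb'
    have := succ_mul_succ_le_of_isLocalBound_prod h0 hb' hn
    omega
  have hpos : 0 < localMult Γ w z := by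
    rw [Nat.pos_iff_ne_zero]
    intro h
    exact h0 (h ▸ hb.localMult)
  have hpos' : 0 < localMult Δ w' z' := by
    rw [Nat.pos_iff_ne_zero]
    intro h
    exact h0' (h ▸ hb'.localMult)
  apply le_antisymm
  · exact (hb.localMult.prod hb'.localMult).localMult_le
  · have := succ_mul_succ_le_of_isLocalBound_prod
      (not_isLocalBound_of_lt (Nat.sub_lt hpos one_pos))
      (not_isLocalBound_of_lt (Nat.sub_lt hpos' one_pos)) hn.localMult
    rwa [show localMult Γ w z - 1 + 1 = localMult Γ w z by omega,
      show localMult Δ w' z' - 1 + 1 = localMult Δ w' z' by omega] at this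

end Multiplicity

/-! ### The topological degree -/

section Degree

variable {X : Type*} [TopologicalSpace X]

/-- The preimages of `z` under all components of `F`. -/
def CorrCycle.fiber (F : CorrCycle X) (z : X) : Set X := ⋃ j, {w | (w, z) ∈ F.comp j}

theorem CorrCycle.topDegree_eq_of_dense [Nonempty X] (F : CorrCycle X) {d : ℕ} {G : Set X}
    (hG : IsOpen G) (hGd : Dense G) (h : ∀ z ∈ G, F.preimageCard z = d) : F.topDegree = d := by
  have hset : {d | ∃ G : Set X, IsOpen G ∧ Dense G ∧ ∀ z ∈ G, F.preimageCard z = d} = {d} := by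
    ext e
    refine ⟨?_, fun he => ⟨G, hG, hGd, fun z hz => (h z hz).trans he.symm⟩⟩
    rintro ⟨G', hG', hGd', h'⟩
    obtain ⟨z, hz, hz'⟩ := (hGd.inter_of_isOpen_left hGd' hG).nonempty
    exact (h' z hz').symm.trans (h z hz)
  rw [CorrCycle.topDegree, hset, csInf_singleton]

theorem CorrCycle.exists_dense_of_topDegree_ne_zero (F : CorrCycle X) (h : F.topDegree ≠ 0) :
    ∃ G : Set X, IsOpen G ∧ Dense G ∧ ∀ z ∈ G, F.preimageCard z = F.topDegree :=
  Nat.sInf_mem (Nat.nonempty_of_pos_sInf (Nat.pos_of_ne_zero h))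

theorem CorrCycle.preimageCard_prod {X Y : Type*} (F : CorrCycle X)
    (F' : CorrCycle Y) (z : X × Y) :
    (F.prod F').preimageCard z = F.preimageCard z.1 * F'.preimageCard z.2 := by
  have h : ∀ i j, {w : X × Y | (w, z) ∈ (F.prod F').comp (i, j)}.ncard =
      {w | (w, z.1) ∈ F.comp i}.ncard * {w | (w, z.2) ∈ F'.comp j}.ncard := by
    intro i j
    rw [← ncard_prod]
    rfl
  unfold CorrCycle.preimageCard
  rw [Finset.sum_mul_sum, ← Finset.sum_product']
  refine Finset.sum_congr rfl fun ij _ => ?_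
  obtain ⟨i, j⟩ := ij
  refine (congrArg _ (h i j)).trans ?_
  change F.coeff i * F'.coeff j * _ = _
  ring

/-- If `F × F` has a nonzero degree, then `F` has a degree, of which it is the square. -/
theorem CorrCycle.topDegree_prod_self [Nonempty X] (F : CorrCycle X)
    (h : (F.prod F).topDegree ≠ 0) :
    (F.prod F).topDegree = F.topDegree * F.topDegree := by
  obtain ⟨G, hG, hGd, hGc⟩ := (F.prod F).exists_dense_of_topDegree_ne_zero h
  simp only [CorrCycle.preimageCard_prod] at hGc
  set D := (F.prod F).topDegree
  obtain ⟨⟨a, b⟩, hab⟩ := hGd.nonempty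
  obtain ⟨A, B, hA, hB, haA, hbB, hAB⟩ := isOpen_prod_iff.1 hG a b hab
  have hbne : F.preimageCard b ≠ 0 := fun hb => h (by rw [← hGc _ hab, hb, mul_zero])
  -- On the slice through `b` the product count is the constant `D`, and the nonzero factor at `b`
  -- cancels.
  have hconst : ∀ x ∈ A, F.preimageCard x = F.preimageCard a := by
    intro x hx
    have h₁ := hGc (x, b) (hAB ⟨hx, hbB⟩)
    have h₂ := hGc (a, b) hab
    exact Nat.eq_of_mul_eq_mul_right (Nat.pos_of_ne_zero hbne) (h₁.trans h₂.symm)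
  have hane : F.preimageCard a ≠ 0 := fun ha => h (by rw [← hGc _ hab, ha, zero_mul])
  -- For any nonempty open `O`, the set `A ×ˢ O` meets `G`; the first coordinate then contributes
  -- the known factor, which determines the second near the point found.
  have hdense : Dense (interior {z | F.preimageCard z = D / F.preimageCard a}) := by
    rw [dense_iff_inter_open]
    intro O hO hOne
    obtain ⟨⟨x, y⟩, ⟨hxA, hyO⟩, hxy⟩ :=
      hGd.inter_open_nonempty _ (hA.prod hO) (Set.Nonempty.prod ⟨a, haA⟩ hOne)
    obtain ⟨A', O', hA', hO', hxA', hyO', hsub⟩ := isOpen_prod_iff.1 hG x y hxy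
    refine ⟨y, hyO, mem_interior.2 ⟨O', fun y' hy' => ?_, hO', hyO'⟩⟩
    have := hGc (x, y') (hsub ⟨hxA', hy'⟩)
    rw [hconst x hxA] at this
    exact (Nat.div_eq_of_eq_mul_right (Nat.pos_of_ne_zero hane) this.symm).symm
  have hval : ∀ z ∈ interior {z | F.preimageCard z = D / F.preimageCard a},
      F.preimageCard z = D / F.preimageCard a := fun z hz =>
    (interior_subset hz : z ∈ {z | F.preimageCard z = D / F.preimageCard a})
  rw [F.topDegree_eq_of_dense isOpen_interior hdense hval]
  refine (F.prod F).topDegree_eq_of_dense (isOpen_interior.prod isOpen_interior)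
    (hdense.prod hdense) fun z hz => ?_
  rw [CorrCycle.preimageCard_prod, hval _ hz.1, hval _ hz.2]

theorem CorrCycle.ncard_le_preimageCard {X : Type*} (F : CorrCycle X) (hc : ∀ j, 0 < F.coeff j)
    (z : X) (j : F.index) : {w | (w, z) ∈ F.comp j}.ncard ≤ F.preimageCard z :=
  (Nat.le_mul_of_pos_left _ (hc j)).trans
    (Finset.single_le_sum (f := fun j => F.coeff j * {w | (w, z) ∈ F.comp j}.ncard)
      (fun _ _ => Nat.zero_le _) (Finset.mem_univ j))

/-- The fibers of a closed correspondence on a compact space are upper semicontinuous. -/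
theorem CorrCycle.eventually_fiber_subset [CompactSpace X] (F : CorrCycle X)
    (hcl : ∀ j, IsClosed (F.comp j)) {z : X} {O : Set X} (hO : IsOpen O) (hz : F.fiber z ⊆ O) :
    ∀ᶠ z' in 𝓝 z, F.fiber z' ⊆ O := by
  have hclosed : IsClosed (Prod.snd '' ((⋃ j, F.comp j) ∩ Prod.fst ⁻¹' Oᶜ)) :=
    isClosedMap_snd_of_compactSpace _
      ((isClosed_iUnion_of_finite hcl).inter (hO.isClosed_compl.preimage continuous_fst))
  have hmem : z ∉ Prod.snd '' ((⋃ j, F.comp j) ∩ Prod.fst ⁻¹' Oᶜ) := by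
    rintro ⟨⟨w, z'⟩, ⟨hw, hwO⟩, rfl⟩
    exact hwO (hz (by simpa [CorrCycle.fiber] using hw))
  filter_upwards [hclosed.isOpen_compl.mem_nhds hmem] with z' hz' w hw
  by_contra hwO
  exact hz' ⟨(w, z'), ⟨by simpa [CorrCycle.fiber] using hw, hwO⟩, rfl⟩

/-- Counted with multiplicity, every point has at least as many preimages as a generic one. -/
theorem CorrCycle.topDegree_le_sum_localMult [CompactSpace X] [T2Space X] (F : CorrCycle X)
    (hc : ∀ j, 0 < F.coeff j) (hcl : ∀ j, IsClosed (F.comp j)) (hd : F.topDegree ≠ 0)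
    (hfin : ∀ z, (F.fiber z).Finite) (z : X) :
    F.topDegree ≤ ∑ j, F.coeff j * ∑ w ∈ (hfin z).toFinset, localMult (F.comp j) w z := by
  obtain ⟨G₀, hG₀, hGd₀, hGc₀⟩ := F.exists_dense_of_topDegree_ne_zero hd
  have hfinj : ∀ z j, {w | (w, z) ∈ F.comp j}.Finite := fun z j =>
    (hfin z).subset (subset_iUnion (fun j => {w | (w, z) ∈ F.comp j}) j)
  -- The generic degree bounds every component globally, so here `localMult` is an attained infimum
  -- and not a default value.
  have hbound : ∀ j w, IsLocalBound (F.comp j) w z (localMult (F.comp j) w z) := by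
    intro j w
    refine IsLocalBound.localMult (n := F.topDegree) ⟨univ, univ_mem, univ, univ_mem, G₀, hG₀,
      hGd₀, fun z' hz' => ?_⟩
    have : {w' ∈ univ | (w', z') ∈ F.comp j} = {w' | (w', z') ∈ F.comp j} := by simp
    rw [this, ← (hfinj z' j).cast_ncard_eq, ← hGc₀ z' hz'.2]
    exact_mod_cast F.ncard_le_preimageCard hc z' j
  choose V hV W hW G hG hGd hle using hbound
  have : Finite (F.index × F.fiber z) := by
    have := (hfin z).to_subtype
    infer_instance
  have hGi : Dense (⋂ p : F.index × F.fiber z, G p.1 p.2) :=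
    dense_iInter_of_isOpen (fun p => hG _ _) (fun p => hGd _ _)
  have hWi : (⋂ p : F.index × F.fiber z, W p.1 p.2) ∈ 𝓝 z := iInter_mem.2 fun p => hW _ _
  let O : Set X := ⋃ w ∈ F.fiber z, interior (⋂ j, V j w)
  have hO : IsOpen O := isOpen_biUnion fun _ _ => isOpen_interior
  have hzO : F.fiber z ⊆ O := fun w hw =>
    mem_biUnion hw (mem_interior_iff_mem_nhds.2 (iInter_mem.2 fun j => hV j w))
  have hnhds := Filter.inter_mem hWi (F.eventually_fiber_subset hcl hO hzO)
  -- A point near `z`, generic for the degree and for all the finitely many local bounds, each of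
  -- whose preimages lies near some preimage of `z`.
  obtain ⟨z', ⟨hz'G₀, hz'G⟩, hz'W, hz'O⟩ :=
    (hGd₀.inter_of_isOpen_left hGi hG₀).inter_nhds_nonempty hnhds
  rw [← hGc₀ z' hz'G₀]
  refine Finset.sum_le_sum fun j _ => Nat.mul_le_mul_left _ ?_
  have hcover : {w | (w, z') ∈ F.comp j} ⊆
      ⋃ w ∈ (hfin z).toFinset, {w' ∈ V j w | (w', z') ∈ F.comp j} := by
    intro w' hw'
    have hw'O : w' ∈ O := hz'O (mem_iUnion.2 ⟨j, hw'⟩)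
    obtain ⟨w, hw, hw'V⟩ := mem_iUnion₂.1 hw'O
    exact mem_iUnion₂.2 ⟨w, (hfin z).mem_toFinset.2 hw,
      mem_iInter.1 (interior_subset hw'V) j, hw'⟩
  have hfinV : ∀ w, {w' ∈ V j w | (w', z') ∈ F.comp j}.Finite := fun w =>
    (hfinj z' j).subset fun _ h => h.2
  refine (ncard_le_ncard hcover ((hfin z).toFinset.finite_toSet.biUnion fun w _ => hfinV w)).trans
    ((Finset.set_ncard_biUnion_le _ _).trans (Finset.sum_le_sum fun w hw => ?_))
  have hw' : w ∈ F.fiber z := (hfin z).mem_toFinset.1 hw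
  have := hle j w z' ⟨mem_iInter.1 hz'W (j, ⟨w, hw'⟩), mem_iInter.1 hz'G (j, ⟨w, hw'⟩)⟩
  rw [← (hfinV w).cast_ncard_eq] at this
  exact_mod_cast this

end Degree

end HolCorr

open ProbabilityTheory in
/-- A family of measures which is almost everywhere a probability measure, and is almost everywhere
measurable on open sets, coincides almost everywhere with a Markov kernel. -/
theorem ProbabilityTheory.Kernel.exists_isMarkovKernel_ae_eq {Ω X : Type*} [MeasurableSpace Ω]
    [TopologicalSpace X] [SecondCountableTopology X] [MeasurableSpace X] [BorelSpace X] [Nonempty X]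
    {μ : Measure Ω} {m : Ω → Measure X} (hm : ∀ᵐ z ∂μ, IsProbabilityMeasure (m z))
    (hmeas : ∀ s, IsOpen s → AEMeasurable (fun z => m z s) μ) :
    ∃ κ : Kernel Ω X, IsMarkovKernel κ ∧ ∀ᵐ z ∂μ, m z = κ z := by
  classical
  let S := TopologicalSpace.countableBasis X
  -- A countable π-system generating the Borel sets: countability puts all exceptional points into
  -- one null set, on which the measures are replaced by a Dirac mass.
  let C : Set (Set X) := (fun f : Set (Set X) => ⋂₀ f) '' {f | f.Finite ∧ f ⊆ S}
  have hS : S.Countable := TopologicalSpace.countable_countableBasis X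
  have hC : C.Countable := (countable_ofPred_finite_subset hS).image _
  have hopen : ∀ s ∈ C, IsOpen s := by
    rintro _ ⟨f, ⟨hf, hfS⟩, rfl⟩
    exact hf.isOpen_sInter fun s hs => TopologicalSpace.isOpen_of_mem_countableBasis (hfS hs)
  have hbasis : TopologicalSpace.IsTopologicalBasis C :=
    TopologicalSpace.isTopologicalBasis_of_subbasis
      (TopologicalSpace.isBasis_countableBasis X).eq_generateFrom
  have hpi : IsPiSystem C := by
    rintro _ ⟨f, ⟨hf, hfS⟩, rfl⟩ _ ⟨g, ⟨hg, hgS⟩, rfl⟩ -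
    exact ⟨f ∪ g, ⟨hf.union hg, union_subset hfS hgS⟩, sInter_union f g⟩
  have hgen : ‹MeasurableSpace X› = MeasurableSpace.generateFrom C := by
    rw [BorelSpace.measurable_eq (α := X), hbasis.borel_eq_generateFrom]
  have hae : ∀ᵐ z ∂μ, IsProbabilityMeasure (m z) ∧
      ∀ s, ∀ hs : s ∈ C, m z s = (hmeas s (hopen s hs)).mk _ z := by
    refine hm.and ((ae_ball_iff hC).2 fun s hs => (hmeas s (hopen s hs)).ae_eq_mk)
  obtain ⟨N, hN, hNm, hN0⟩ := exists_measurable_superset_of_null (ae_iff.1 hae)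
  have hgood : ∀ z ∉ N, IsProbabilityMeasure (m z) ∧
      ∀ s, ∀ hs : s ∈ C, m z s = (hmeas s (hopen s hs)).mk _ z := by
    intro z hz
    by_contra h
    exact hz (hN h)
  obtain ⟨x₀⟩ := ‹Nonempty X›
  let k : Ω → Measure X := fun z => if z ∈ N then Measure.dirac x₀ else m z
  have hk : ∀ z, IsProbabilityMeasure (k z) := by
    intro z
    by_cases hz : z ∈ N
    · simp only [k, hz, if_true]
      infer_instance
    · simp only [k, hz, if_false]
      exact (hgood z hz).1
  have hkm : Measurable k := by
    refine Measurable.measure_of_isPiSystem_of_isProbabilityMeasure hgen hpi fun s hs => ?_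
    have : (fun z => k z s) = fun z =>
        if z ∈ N then Measure.dirac x₀ s else (hmeas s (hopen s hs)).mk _ z := by
      ext z
      by_cases hz : z ∈ N
      · simp [k, hz]
      · simpa [k, hz] using (hgood z hz).2 s hs
    rw [this]
    exact Measurable.ite hNm measurable_const (hmeas s (hopen s hs)).measurable_mk
  refine ⟨⟨k, hkm⟩, ⟨hk⟩, ?_⟩
  filter_upwards [measure_eq_zero_iff_ae_notMem.1 hN0] with z hz
  simp [k, hz]

namespace HolCorr

/-! ### Transition measures of a correspondence -/

section Transition

variable {X : Type*}

/-- All components of `F` are closed and all points have finitely many preimages. -/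
structure CorrCycle.IsClosedFinite [TopologicalSpace X] (F : CorrCycle X) : Prop where
  closed : ∀ j, IsClosed (F.comp j)
  finite : ∀ z, (F.fiber z).Finite

variable [TopologicalSpace X]

/-- The number of times that `w` is counted as a preimage of `z`, divided by the degree. -/
noncomputable def CorrCycle.weight (F : CorrCycle X) (w z : X) : ℝ :=
  1 / (F.topDegree : ℝ) * ∑ j, (F.coeff j : ℝ) * localMult (F.comp j) w z

theorem CorrCycle.weight_nonneg (F : CorrCycle X) (w z : X) : 0 ≤ F.weight w z := by
  unfold CorrCycle.weight
  positivity

theorem CorrCycle.IsClosedFinite.weight_eq_zero {F : CorrCycle X} (hF : F.IsClosedFinite) {w z : X}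
    (h : w ∉ F.fiber z) : F.weight w z = 0 := by
  unfold CorrCycle.weight
  rw [Finset.sum_eq_zero, mul_zero]
  intro j _
  rw [localMult_eq_zero_of_notMem (hF.closed j) fun hw => h (mem_iUnion.2 ⟨j, hw⟩)]
  simp

theorem CorrCycle.IsClosedFinite.koopman_eq_sum {F : CorrCycle X} (hF : F.IsClosedFinite)
    (φ : X → ℝ) (z : X) :
    F.koopman φ z = ∑ w ∈ (hF.finite z).toFinset, F.weight w z * φ w := by
  unfold CorrCycle.koopman CorrCycle.preimageSum CorrCycle.weight
  simp only [mul_assoc, ← Finset.mul_sum, Finset.sum_mul]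
  rw [Finset.sum_comm]
  congr 1
  refine Finset.sum_congr rfl fun j _ => ?_
  rw [← Finset.mul_sum]
  congr 1
  refine finsum_eq_sum_of_support_subset _ fun w hw => ?_
  by_contra hwz
  refine hw ?_
  have hwz' : (w, z) ∉ F.comp j := fun h =>
    hwz (Finset.mem_coe.2 ((hF.finite z).mem_toFinset.2 (mem_iUnion.2 ⟨j, h⟩)))
  simp [localMult_eq_zero_of_notMem (hF.closed j) hwz']

theorem CorrCycle.koopman_eq_zero (F : CorrCycle X) (h : F.topDegree = 0) (φ : X → ℝ) :
    F.koopman φ = 0 := by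
  ext z
  simp [CorrCycle.koopman, h]

theorem CorrCycle.IsClosedFinite.koopman_add {F : CorrCycle X} (hF : F.IsClosedFinite)
    (φ ψ : X → ℝ) : F.koopman (φ + ψ) = F.koopman φ + F.koopman ψ := by
  ext z
  simp only [hF.koopman_eq_sum, Pi.add_apply, mul_add, Finset.sum_add_distrib]

theorem CorrCycle.IsClosedFinite.koopman_smul {F : CorrCycle X} (hF : F.IsClosedFinite)
    (c : ℝ) (φ : X → ℝ) : F.koopman (c • φ) = c • F.koopman φ := by
  ext z
  simp only [hF.koopman_eq_sum, Pi.smul_apply, smul_eq_mul, Finset.mul_sum]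
  exact Finset.sum_congr rfl fun w _ => by ring

theorem CorrCycle.IsClosedFinite.one_le_koopman_one [CompactSpace X] [T2Space X]
    {F : CorrCycle X} (hF : F.IsClosedFinite) (hc : ∀ j, 0 < F.coeff j) (hd : F.topDegree ≠ 0)
    (z : X) : 1 ≤ F.koopman 1 z := by
  have hle := F.topDegree_le_sum_localMult hc hF.closed hd hF.finite z
  have hsum : F.koopman 1 z = 1 / (F.topDegree : ℝ) *
      ((∑ j, F.coeff j * ∑ w ∈ (hF.finite z).toFinset, localMult (F.comp j) w z : ℕ) : ℝ) := by
    rw [hF.koopman_eq_sum]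
    simp only [CorrCycle.weight, Pi.one_apply, mul_one, ← Finset.mul_sum]
    rw [Finset.sum_comm]
    push_cast
    simp only [Finset.mul_sum]
  have hpos : (0 : ℝ) < F.topDegree := by exact_mod_cast Nat.pos_of_ne_zero hd
  rw [hsum, one_div, ← div_eq_inv_mul, le_div_iff₀ hpos, one_mul]
  exact_mod_cast hle

variable [MeasurableSpace X]

/-- The measure `φ ↦ U_F φ z`. -/
noncomputable def CorrCycle.transition (F : CorrCycle X) (z : X) : Measure X :=
  ∑ᶠ w, ENNReal.ofReal (F.weight w z) • Measure.dirac w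

theorem CorrCycle.IsClosedFinite.transition_eq_sum {F : CorrCycle X} (hF : F.IsClosedFinite)
    (z : X) : F.transition z =
      ∑ w ∈ (hF.finite z).toFinset, ENNReal.ofReal (F.weight w z) • Measure.dirac w := by
  refine finsum_eq_sum_of_support_subset _ fun w hw => ?_
  by_contra hwz
  refine hw ?_
  simp [hF.weight_eq_zero (w := w) (z := z) (by simpa using hwz)]

theorem CorrCycle.IsClosedFinite.isFiniteMeasure_transition {F : CorrCycle X}
    (hF : F.IsClosedFinite) (z : X) : IsFiniteMeasure (F.transition z) := by
  rw [hF.transition_eq_sum]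
  have : ∀ w, IsFiniteMeasure (ENNReal.ofReal (F.weight w z) • Measure.dirac w) := fun w =>
    Measure.smul_finite _ ENNReal.ofReal_ne_top
  infer_instance

theorem CorrCycle.IsClosedFinite.koopman_eq_integral [MeasurableSingletonClass X] {F : CorrCycle X}
    (hF : F.IsClosedFinite) (φ : X → ℝ) (z : X) :
    F.koopman φ z = ∫ w, φ w ∂(F.transition z) := by
  rw [hF.koopman_eq_sum, hF.transition_eq_sum, integral_finsetSum_measure]
  · refine Finset.sum_congr rfl fun w _ => ?_
    rw [integral_smul_measure, integral_dirac, ENNReal.toReal_ofReal (F.weight_nonneg w z),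
      smul_eq_mul]
  · intro w _
    exact (integrable_dirac (by simp)).smul_measure ENNReal.ofReal_ne_top

theorem CorrCycle.IsClosedFinite.isProbabilityMeasure_transition [MeasurableSingletonClass X]
    {F : CorrCycle X} (hF : F.IsClosedFinite) {z : X} (h : F.koopman 1 z = 1) :
    IsProbabilityMeasure (F.transition z) := by
  have := hF.isFiniteMeasure_transition z
  rw [hF.koopman_eq_integral] at h
  simpa [isProbabilityMeasure_iff_real] using h

end Transition

end HolCorr

namespace HolCorr

open ProbabilityTheory

/-! ### From invariance to a Markov kernel preserving `μ` -/

section Invariance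

variable {X : Type*} [TopologicalSpace X] [MeasurableSpace X] {F : CorrCycle X} {μ : Measure X}

/-- The correspondence acts, outside a null set, as a Markov kernel that preserves `μ`. -/
def CorrCycle.ActsAsMarkovKernel (F : CorrCycle X) (μ : Measure X) : Prop :=
  ∃ κ : Kernel X X, IsMarkovKernel κ ∧ κ ∘ₘ μ = μ ∧
    ∀ᵐ z ∂μ, ∀ φ : X → ℝ, F.koopman φ z = ∫ w, φ w ∂(κ z)

theorem CorrCycle.IsPullbackInvariant.integral_koopman (hμ : F.IsPullbackInvariant μ)
    (hd : F.topDegree ≠ 0) (φ : C(X, ℝ)) : ∫ z, F.koopman φ z ∂μ = ∫ z, φ z ∂μ := by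
  have hd' : (F.topDegree : ℝ) ≠ 0 := by exact_mod_cast hd
  unfold CorrCycle.koopman
  rw [integral_const_mul, hμ φ]
  field_simp

/-- By linearity, invariance forces the functions `U_F φ` to be integrable. -/
theorem CorrCycle.IsPullbackInvariant.integrable_koopman [CompactSpace X] [OpensMeasurableSpace X]
    [IsProbabilityMeasure μ] (hF : F.IsClosedFinite) (hμ : F.IsPullbackInvariant μ)
    (hd : F.topDegree ≠ 0) (φ : C(X, ℝ)) : Integrable (F.koopman φ) μ := by
  have hne : ∀ ψ : C(X, ℝ), ∫ z, ψ z ∂μ ≠ 0 → Integrable (F.koopman ψ) μ := by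
    intro ψ hψ
    by_contra h
    -- The Bochner integral of a nonintegrable function is `0`, so a nonzero mean forces
    -- integrability. A `φ` of mean `0` is written as `(φ + 1) - 1`.
    exact hψ ((hμ.integral_koopman hd ψ).symm.trans (integral_undef h))
  by_cases h0 : ∫ z, φ z ∂μ = 0
  · have hint : Integrable φ μ := φ.continuous.integrable_of_hasCompactSupport
      (HasCompactSupport.of_compactSpace _)
    have h1 : Integrable (F.koopman (1 : C(X, ℝ))) μ := hne 1 (by simp)
    have h2 : Integrable (F.koopman (φ + 1 : C(X, ℝ))) μ := by
      refine hne _ ?_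
      have : ∫ z, (φ + 1 : C(X, ℝ)) z ∂μ = ∫ z, φ z ∂μ + ∫ _, (1 : ℝ) ∂μ :=
        integral_add hint (integrable_const _)
      rw [this, h0]
      simp
    rw [ContinuousMap.coe_add, hF.koopman_add] at h2
    simpa using h2.sub h1
  · exact hne φ h0

/-- Every point has at least the generic number of preimages, and the mean of this number is the
generic one, so almost all points have the generic number of preimages. -/
theorem CorrCycle.IsPullbackInvariant.koopman_one_ae [CompactSpace X] [T2Space X]
    [OpensMeasurableSpace X] [IsProbabilityMeasure μ] (hF : F.IsClosedFinite)
    (hc : ∀ j, 0 < F.coeff j) (hμ : F.IsPullbackInvariant μ) (hd : F.topDegree ≠ 0) :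
    ∀ᵐ z ∂μ, F.koopman 1 z = 1 := by
  have hint : Integrable (F.koopman 1) μ := hμ.integrable_koopman hF hd 1
  have hval : ∫ z, F.koopman 1 z ∂μ = 1 := by
    have := hμ.integral_koopman hd 1
    simpa using this
  have hsub : Integrable (fun z => F.koopman 1 z - 1) μ := hint.sub (integrable_const _)
  have hzero : ∫ z, (F.koopman 1 z - 1) ∂μ = 0 := by
    rw [integral_sub hint (integrable_const _), hval]
    simp
  have hnonneg : 0 ≤ fun z => F.koopman 1 z - 1 := fun z =>
    sub_nonneg.2 (hF.one_le_koopman_one hc hd z)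
  filter_upwards [(integral_eq_zero_iff_of_nonneg hnonneg hsub).1 hzero] with z hz
  exact sub_eq_zero.1 hz

/-- The indicator of a closed set is a limit of continuous functions, whose images under `U_F` are
integrable. Open sets follow by complements, the total mass being `1` almost everywhere. -/
theorem CorrCycle.IsPullbackInvariant.aemeasurable_transition [CompactSpace X]
    [HasOuterApproxClosed X] [BorelSpace X] [MeasurableSingletonClass X]
    [IsProbabilityMeasure μ] (hF : F.IsClosedFinite)
    (hμ : F.IsPullbackInvariant μ) (hd : F.topDegree ≠ 0)
    (h1 : ∀ᵐ z ∂μ, F.koopman 1 z = 1) {s : Set X} (hs : IsOpen s) :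
    AEMeasurable (fun z => F.transition z s) μ := by
  have hclosed : AEMeasurable (fun z => F.transition z sᶜ) μ := by
    have hsc : IsClosed sᶜ := hs.isClosed_compl
    refine aemeasurable_of_tendsto_metrizable_ae atTop
      (f := fun n z => ENNReal.ofReal (F.koopman (fun x => (hsc.apprSeq n x : ℝ)) z))
      (fun n => ?_) (Eventually.of_forall fun z => ?_)
    · let φ : C(X, ℝ) := ⟨fun x => (hsc.apprSeq n x : ℝ),
        NNReal.continuous_coe.comp (hsc.apprSeq n).continuous⟩
      exact (hμ.integrable_koopman hF hd φ).aemeasurable.ennreal_ofReal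
    · have := hF.isFiniteMeasure_transition z
      convert HasOuterApproxClosed.tendsto_lintegral_apprSeq hsc (F.transition z) using 2 with n
      rw [hF.koopman_eq_integral, ofReal_integral_eq_lintegral_ofReal]
      · simp
      · refine Integrable.of_bound
          (NNReal.continuous_coe.comp (hsc.apprSeq n).continuous).aestronglyMeasurable 1
          (Eventually.of_forall fun x => ?_)
        simpa using HasOuterApproxClosed.apprSeq_apply_le_one hsc n x
      · exact Eventually.of_forall fun x => NNReal.coe_nonneg _
  refine (aemeasurable_const (b := (1 : ENNReal)) |>.sub hclosed).congr ?_
  filter_upwards [h1] with z hz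
  have := hF.isProbabilityMeasure_transition hz
  exact (prob_compl_eq_one_sub hs.measurableSet.compl).symm.trans (by rw [compl_compl])

/-- The transition measures form, outside a null set, a Markov kernel that preserves `μ`. -/
theorem CorrCycle.IsPullbackInvariant.exists_isMarkovKernel [CompactSpace X] [T2Space X]
    [SecondCountableTopology X] [BorelSpace X] [IsProbabilityMeasure μ]
    (hF : F.IsClosedFinite) (hc : ∀ j, 0 < F.coeff j) (hμ : F.IsPullbackInvariant μ)
    (hd : F.topDegree ≠ 0) :
    ∃ κ : Kernel X X, IsMarkovKernel κ ∧ κ ∘ₘ μ = μ ∧ ∀ᵐ z ∂μ, F.transition z = κ z := by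
  let _ := TopologicalSpace.metrizableSpaceMetric X
  have : Nonempty X := μ.nonempty_of_neZero
  have h1 := hμ.koopman_one_ae hF hc hd
  obtain ⟨κ, hκ, hκae⟩ := Kernel.exists_isMarkovKernel_ae_eq
    (h1.mono fun z hz => hF.isProbabilityMeasure_transition hz)
    (fun s hs => hμ.aemeasurable_transition hF hd h1 hs)
  refine ⟨κ, hκ, ?_, hκae⟩
  refine ext_of_forall_integral_eq_of_IsFiniteMeasure fun f => ?_
  refine Eq.trans ?_ (hμ.integral_koopman hd f.toContinuousMap)
  rw [Measure.comp_eq_comp_const_apply,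
    Kernel.integral_comp (f.integrable _)]
  simp only [Kernel.const_apply]
  refine integral_congr_ae ?_
  filter_upwards [hκae] with z hz
  rw [hF.koopman_eq_integral, hz]
  rfl

end Invariance

/-! ### The product correspondence acts as the product kernel -/

section Product

variable {X : Type*} [TopologicalSpace X] {F : CorrCycle X}

theorem CorrCycle.fiber_prod {X : Type*} (F : CorrCycle X) (z : X × X) :
    (F.prod F).fiber z = F.fiber z.1 ×ˢ F.fiber z.2 := by
  ext w
  simp only [CorrCycle.fiber, mem_iUnion, mem_prod]
  exact ⟨fun ⟨ij, h⟩ => ⟨⟨ij.1, h.1⟩, ⟨ij.2, h.2⟩⟩, fun ⟨⟨i, h⟩, ⟨j, h'⟩⟩ => ⟨(i, j), ⟨h, h'⟩⟩⟩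

theorem CorrCycle.IsClosedFinite.prod (hF : F.IsClosedFinite) : (F.prod F).IsClosedFinite where
  closed ij := by
    change IsClosed ((fun p : (X × X) × (X × X) => (p.1.1, p.2.1)) ⁻¹' F.comp ij.1 ∩
      (fun p : (X × X) × (X × X) => (p.1.2, p.2.2)) ⁻¹' F.comp ij.2)
    exact ((hF.closed _).preimage (by fun_prop)).inter ((hF.closed _).preimage (by fun_prop))
  finite z := by
    rw [CorrCycle.fiber_prod]
    exact (hF.finite z.1).prod (hF.finite z.2)

/-- Combines multiplicativity of the local multiplicities with the degree being a square, which is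
where `hd` enters. -/
theorem CorrCycle.weight_prod [Nonempty X] (hd : (F.prod F).topDegree ≠ 0) (w z : X × X) :
    (F.prod F).weight w z = F.weight w.1 z.1 * F.weight w.2 z.2 := by
  have hm : ∀ ij : F.index × F.index, localMult ((F.prod F).comp ij) w z =
      localMult (F.comp ij.1) w.1 z.1 * localMult (F.comp ij.2) w.2 z.2 := fun ij =>
    localMult_relProd _ _ _ _ _ _
  have hs : (∑ ij, ((F.prod F).coeff ij : ℝ) * localMult ((F.prod F).comp ij) w z) =
      (∑ j, (F.coeff j : ℝ) * localMult (F.comp j) w.1 z.1) *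
        ∑ j, (F.coeff j : ℝ) * localMult (F.comp j) w.2 z.2 := by
    rw [Finset.sum_mul_sum, ← Finset.sum_product']
    refine Finset.sum_congr rfl fun ij _ => ?_
    obtain ⟨i, j⟩ := ij
    rw [show localMult ((F.prod F).comp (i, j)) w z = _ from hm (i, j)]
    change ((F.coeff i * F.coeff j : ℕ) : ℝ) * _ = _
    push_cast
    ring
  unfold CorrCycle.weight
  rw [hs, CorrCycle.topDegree_prod_self F hd]
  push_cast
  rw [one_div, mul_inv]
  ring

variable [MeasurableSpace X]

theorem CorrCycle.IsClosedFinite.transition_prod [Nonempty X]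
    (hF : F.IsClosedFinite) (hd : (F.prod F).topDegree ≠ 0) (z : X × X) :
    (F.prod F).transition z = (F.transition z.1).prod (F.transition z.2) := by
  have := hF.isFiniteMeasure_transition z.1
  have := hF.isFiniteMeasure_transition z.2
  refine (Measure.prod_eq fun s t hs ht => ?_).symm
  have hfib : (hF.prod.finite z).toFinset =
      (hF.finite z.1).toFinset ×ˢ (hF.finite z.2).toFinset := by
    ext w
    simp [CorrCycle.fiber_prod]
  simp only [hF.transition_eq_sum, hF.prod.transition_eq_sum, hfib, Measure.finsetSum_apply,
    Measure.smul_apply, Measure.dirac_apply' _ hs, Measure.dirac_apply' _ ht,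
    Measure.dirac_apply' _ (hs.prod ht), smul_eq_mul]
  rw [Finset.sum_mul_sum, ← Finset.sum_product']
  refine Finset.sum_congr rfl fun w _ => ?_
  rw [CorrCycle.weight_prod hd, ENNReal.ofReal_mul (F.weight_nonneg _ _)]
  by_cases h₁ : w.1 ∈ s <;> by_cases h₂ : w.2 ∈ t <;> simp [h₁, h₂]

theorem CorrCycle.IsClosedFinite.actsAsMarkovKernel_prod [MeasurableSingletonClass X] {μ : Measure X}
    [IsProbabilityMeasure μ] (hF : F.IsClosedFinite) (hd : (F.prod F).topDegree ≠ 0)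
    {κ : Kernel X X} [IsMarkovKernel κ] (hκ : κ ∘ₘ μ = μ) (hae : ∀ᵐ z ∂μ, F.transition z = κ z) :
    (F.prod F).ActsAsMarkovKernel (μ.prod μ) := by
  have : Nonempty X := μ.nonempty_of_neZero
  refine ⟨κ ∥ₖ κ, inferInstance, ?_, ?_⟩
  · refine (Measure.prod_eq fun s t hs ht => ?_).symm
    have hprod : ∀ z : X × X, (κ ∥ₖ κ) z (s ×ˢ t) = κ z.1 s * κ z.2 t := fun z => by
      rw [Kernel.parallelComp_apply, Measure.prod_prod]
    rw [Measure.bind_apply (hs.prod ht) (Kernel.aemeasurable _)]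
    simp only [hprod]
    rw [lintegral_prod_mul (κ.measurable_coe hs).aemeasurable (κ.measurable_coe ht).aemeasurable,
      ← Measure.bind_apply hs (Kernel.aemeasurable _),
      ← Measure.bind_apply ht (Kernel.aemeasurable _), hκ]
  · filter_upwards [Measure.quasiMeasurePreserving_fst.ae hae,
      Measure.quasiMeasurePreserving_snd.ae hae] with z h₁ h₂ φ
    rw [hF.prod.koopman_eq_integral, hF.transition_prod hd, h₁, h₂, Kernel.parallelComp_apply]

end Product

end HolCorr

namespace HolCorr

open ProbabilityTheory

/-! ### Sequences that tend to zero in the strong Cesàro sense -/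

/-- The Cesàro means of `|a|` tend to zero. -/
def CesaroNull (a : ℕ → ℝ) : Prop :=
  Tendsto (fun n : ℕ => 1 / (n : ℝ) * ∑ j ∈ Finset.range n, |a j|) atTop (𝓝 0)

theorem cesaro_nonneg (a : ℕ → ℝ) (n : ℕ) :
    0 ≤ 1 / (n : ℝ) * ∑ j ∈ Finset.range n, |a j| := by
  positivity

theorem CesaroNull.zero : CesaroNull 0 := by
  simp [CesaroNull]

theorem CesaroNull.add {a b : ℕ → ℝ} (ha : CesaroNull a) (hb : CesaroNull b) :
    CesaroNull (a + b) := by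
  have h := Tendsto.add ha hb
  rw [add_zero] at h
  refine squeeze_zero (cesaro_nonneg _) (fun n => ?_) h
  rw [← mul_add, ← Finset.sum_add_distrib]
  gcongr
  exact abs_add_le _ _

theorem CesaroNull.smul {a : ℕ → ℝ} (c : ℝ) (ha : CesaroNull a) : CesaroNull (c • a) := by
  have h := Tendsto.const_mul |c| ha
  rw [mul_zero] at h
  refine h.congr fun n => ?_
  simp only [Pi.smul_apply, smul_eq_mul, abs_mul, ← Finset.mul_sum]
  ring

/-- A uniform limit of null sequences is null. -/
theorem CesaroNull.of_forall_exists {a : ℕ → ℝ}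
    (h : ∀ ε > 0, ∃ b, CesaroNull b ∧ ∀ j, |a j - b j| ≤ ε) : CesaroNull a := by
  rw [CesaroNull, Metric.tendsto_nhds]
  intro ε hε
  obtain ⟨b, hb, hab⟩ := h (ε / 2) (half_pos hε)
  filter_upwards [(Metric.tendsto_nhds.1 hb) (ε / 2) (half_pos hε), eventually_gt_atTop 0]
    with n hn hn0
  rw [Real.dist_0_eq_abs, abs_of_nonneg (cesaro_nonneg _ _)] at hn ⊢
  have hn0' : (0 : ℝ) < n := by exact_mod_cast hn0
  calc 1 / (n : ℝ) * ∑ j ∈ Finset.range n, |a j|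
      ≤ 1 / (n : ℝ) * ∑ j ∈ Finset.range n, (|b j| + ε / 2) := by
        gcongr with j
        linarith [abs_sub_abs_le_abs_sub (a j) (b j), hab j]
    _ = 1 / (n : ℝ) * ∑ j ∈ Finset.range n, |b j| + ε / 2 := by
        rw [Finset.sum_add_distrib, Finset.sum_const, Finset.card_range, nsmul_eq_mul]
        field_simp
    _ < ε := by linarith

/-! ### Iterates of the Koopman operator -/

section Iterates

variable {Y : Type*} [TopologicalSpace Y]

/-- The Koopman operator as a linear map. -/
noncomputable def CorrCycle.IsClosedFinite.koopmanHom {F : CorrCycle Y} (hF : F.IsClosedFinite) :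
    Module.End ℝ (Y → ℝ) where
  toFun := F.koopman
  map_add' := hF.koopman_add
  map_smul' := hF.koopman_smul

theorem CorrCycle.IsClosedFinite.iterate_koopman {F : CorrCycle Y} (hF : F.IsClosedFinite) (n : ℕ)
    (φ : Y → ℝ) : F.koopman^[n] φ = (hF.koopmanHom ^ n) φ :=
  (Module.End.pow_apply hF.koopmanHom n φ).symm

variable [CompactSpace Y] [MeasurableSpace Y]

/-- The iterates of the Koopman operator contract the supremum norm of continuous functions. -/
def CorrCycle.IsKoopmanContraction (F : CorrCycle Y) (ν : Measure Y) : Prop :=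
  ∀ (n : ℕ) (φ : C(Y, ℝ)), AEStronglyMeasurable (F.koopman^[n] φ) ν ∧
    ∀ᵐ z ∂ν, ‖(F.koopman^[n] φ) z‖ ≤ ‖φ‖

theorem CorrCycle.isKoopmanContraction_of_topDegree_eq_zero [OpensMeasurableSpace Y]
    {F : CorrCycle Y} {ν : Measure Y} (h : F.topDegree = 0) : F.IsKoopmanContraction ν := by
  rintro (_ | n) φ
  · exact ⟨φ.continuous.aestronglyMeasurable, Eventually.of_forall φ.norm_coe_le_norm⟩
  · rw [Function.iterate_succ_apply', F.koopman_eq_zero h]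
    exact ⟨aestronglyMeasurable_zero, by simp⟩

/-- Induction on `n`: since `κ` preserves `ν`, a `ν`-null set is `κ z`-null for almost every `z`, so
both the bound and the equality with a measurable representative survive integration against `κ z`.
-/
theorem CorrCycle.ActsAsMarkovKernel.isKoopmanContraction [OpensMeasurableSpace Y]
    {F : CorrCycle Y} {ν : Measure Y} (h : F.ActsAsMarkovKernel ν) :
    F.IsKoopmanContraction ν := by
  obtain ⟨κ, hκ, hinv, hae⟩ := h
  intro n φ
  induction n with
  | zero => exact ⟨φ.continuous.aestronglyMeasurable, Eventually.of_forall φ.norm_coe_le_norm⟩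
  | succ n ih =>
    obtain ⟨hm, hb⟩ := ih
    rw [Function.iterate_succ_apply']
    set f := F.koopman^[n] φ
    have hmk : ∀ᵐ z ∂ν, ∀ᵐ w ∂(κ z), f w = hm.mk f w :=
      Measure.ae_ae_of_ae_comp (hinv.symm ▸ hm.ae_eq_mk)
    have hbκ : ∀ᵐ z ∂ν, ∀ᵐ w ∂(κ z), ‖f w‖ ≤ ‖φ‖ :=
      Measure.ae_ae_of_ae_comp (hinv.symm ▸ hb)
    constructor
    · refine ⟨fun z => ∫ w, hm.mk f w ∂(κ z), hm.stronglyMeasurable_mk.integral_kernel, ?_⟩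
      filter_upwards [hae, hmk] with z hz hz'
      rw [hz f]
      exact integral_congr_ae hz'
    · filter_upwards [hae, hbκ] with z hz hz'
      rw [hz f]
      simpa using norm_integral_le_of_norm_le_const hz'

end Iterates

/-! ### Density arguments -/

section Density

variable {Y : Type*} [TopologicalSpace Y] [CompactSpace Y] [MeasurableSpace Y]
  {F : CorrCycle Y} {ν : Measure Y}

/-- The sequence `I_n(φ, ψ) - I(φ) I(ψ)`. -/
noncomputable def CorrCycle.deviation {Y : Type*} [TopologicalSpace Y] [MeasurableSpace Y]
    (F : CorrCycle Y) (ν : Measure Y) (φ ψ : Y → ℝ) (j : ℕ) : ℝ :=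
  F.correlation ν j φ ψ - (∫ z, φ z ∂ν) * ∫ z, ψ z ∂ν

theorem CorrCycle.IsKoopmanContraction.integrable_mul (h : F.IsKoopmanContraction ν) (n : ℕ)
    (φ : C(Y, ℝ)) {ψ : Y → ℝ} (hψ : Integrable ψ ν) :
    Integrable (fun z => (F.koopman^[n] φ) z * ψ z) ν :=
  hψ.bdd_mul (h n φ).1 (h n φ).2

theorem CorrCycle.IsKoopmanContraction.deviation_add_right (h : F.IsKoopmanContraction ν)
    (φ : C(Y, ℝ)) {ψ ψ' : Y → ℝ} (hψ : Integrable ψ ν) (hψ' : Integrable ψ' ν) :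
    F.deviation ν φ (ψ + ψ') = F.deviation ν φ ψ + F.deviation ν φ ψ' := by
  ext j
  simp only [CorrCycle.deviation, CorrCycle.correlation, Pi.add_apply, mul_add]
  rw [integral_add (h.integrable_mul j φ hψ) (h.integrable_mul j φ hψ'), integral_add hψ hψ']
  ring

theorem CorrCycle.deviation_smul_right {Y : Type*} [TopologicalSpace Y] [MeasurableSpace Y]
    (F : CorrCycle Y) (ν : Measure Y)
    (φ : Y → ℝ) (c : ℝ) (ψ : Y → ℝ) :
    F.deviation ν φ (c • ψ) = c • F.deviation ν φ ψ := by
  ext j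
  simp only [CorrCycle.deviation, CorrCycle.correlation, Pi.smul_apply, smul_eq_mul,
    mul_left_comm _ c, integral_const_mul]
  ring

theorem CorrCycle.IsKoopmanContraction.deviation_sub_right (h : F.IsKoopmanContraction ν)
    (φ : C(Y, ℝ)) {ψ ψ' : Y → ℝ} (hψ : Integrable ψ ν) (hψ' : Integrable ψ' ν) :
    F.deviation ν φ (ψ - ψ') = F.deviation ν φ ψ - F.deviation ν φ ψ' := by
  have := h.deviation_add_right φ hψ (hψ'.smul (-1 : ℝ))
  rw [CorrCycle.deviation_smul_right] at this
  simpa [sub_eq_add_neg] using this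

theorem CorrCycle.deviation_congr_right {Y : Type*} [TopologicalSpace Y] [MeasurableSpace Y]
    (F : CorrCycle Y) {ν : Measure Y} {φ ψ ψ' : Y → ℝ} (hψ : ψ =ᵐ[ν] ψ') :
    F.deviation ν φ ψ = F.deviation ν φ ψ' := by
  ext j
  unfold CorrCycle.deviation CorrCycle.correlation
  rw [integral_congr_ae hψ]
  congr 1
  refine integral_congr_ae ?_
  filter_upwards [hψ] with z hz
  rw [hz]

/-- Uniformity in `j` is the point: approximating `φ` or `ψ` then approximates the whole deviation
sequence. -/
theorem CorrCycle.IsKoopmanContraction.abs_deviation_le [IsProbabilityMeasure ν]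
    (h : F.IsKoopmanContraction ν)
    (φ : C(Y, ℝ)) {ψ : Y → ℝ} (hψ : Integrable ψ ν) (j : ℕ) :
    |F.deviation ν φ ψ j| ≤ 2 * ‖φ‖ * ∫ z, ‖ψ z‖ ∂ν := by
  have h₁ : |F.correlation ν j φ ψ| ≤ ‖φ‖ * ∫ z, ‖ψ z‖ ∂ν := by
    rw [← integral_const_mul, ← Real.norm_eq_abs]
    refine norm_integral_le_of_norm_le (hψ.norm.const_mul _) ?_
    filter_upwards [(h j φ).2] with z hz
    rw [norm_mul]
    gcongr
  have h₂ : |∫ z, φ z ∂ν| ≤ ‖φ‖ := by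
    simpa using norm_integral_le_of_norm_le_const (μ := ν)
      (Eventually.of_forall φ.norm_coe_le_norm)
  have h₃ : |∫ z, ψ z ∂ν| ≤ ∫ z, ‖ψ z‖ ∂ν := norm_integral_le_integral_norm ψ
  calc |F.deviation ν φ ψ j|
      ≤ |F.correlation ν j φ ψ| + |(∫ z, φ z ∂ν) * ∫ z, ψ z ∂ν| := abs_sub _ _
    _ ≤ ‖φ‖ * ∫ z, ‖ψ z‖ ∂ν + ‖φ‖ * ∫ z, ‖ψ z‖ ∂ν := by
        rw [abs_mul]
        gcongr
    _ = 2 * ‖φ‖ * ∫ z, ‖ψ z‖ ∂ν := by ring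

/-- A null deviation passes to limits of `ψ` in `L¹`. -/
theorem CorrCycle.IsKoopmanContraction.cesaroNull_of_forall_exists_right
    [IsProbabilityMeasure ν] (h : F.IsKoopmanContraction ν) (φ : C(Y, ℝ)) {ψ : Y → ℝ}
    (hψ : Integrable ψ ν) (happ : ∀ ε > 0, ∃ ψ', Integrable ψ' ν ∧ CesaroNull (F.deviation ν φ ψ') ∧
      ∫ z, ‖ψ z - ψ' z‖ ∂ν < ε) :
    CesaroNull (F.deviation ν φ ψ) := by
  refine CesaroNull.of_forall_exists fun ε hε => ?_
  -- The `+ 1` keeps the denominator positive when `φ = 0`.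
  obtain ⟨ψ', hψ', hn, hd⟩ := happ (ε / (2 * ‖φ‖ + 1)) (by positivity)
  refine ⟨_, hn, fun j => ?_⟩
  rw [← Pi.sub_apply, ← h.deviation_sub_right φ hψ hψ']
  refine (h.abs_deviation_le φ (hψ.sub hψ') j).trans ?_
  rw [lt_div_iff₀ (by positivity)] at hd
  have : 0 ≤ ∫ z, ‖ψ z - ψ' z‖ ∂ν := integral_nonneg fun _ => norm_nonneg _
  simp only [Pi.sub_apply]
  nlinarith

theorem integrable_indicator_one {Y : Type*} [MeasurableSpace Y] {ν : Measure Y}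
    [IsProbabilityMeasure ν] {s : Set Y} (hs : MeasurableSet s) :
    Integrable (s.indicator fun _ => (1 : ℝ)) ν :=
  (integrable_const 1).indicator hs

/-- A null deviation from the indicators of a generating `π`-system gives null deviations from the
indicators of all measurable sets. -/
theorem CorrCycle.IsKoopmanContraction.cesaroNull_indicator [IsProbabilityMeasure ν]
    (h : F.IsKoopmanContraction ν) (φ : C(Y, ℝ)) {C : Set (Set Y)}
    (hgen : ‹MeasurableSpace Y› = MeasurableSpace.generateFrom C)
    (hpi : IsPiSystem C) (huniv : univ ∈ C)
    (hC : ∀ s ∈ C, CesaroNull (F.deviation ν φ (s.indicator fun _ => 1)))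
    {s : Set Y} (hs : MeasurableSet s) :
    CesaroNull (F.deviation ν φ (s.indicator fun _ => 1)) := by
  have hzero : CesaroNull (F.deviation ν φ (0 : Y → ℝ)) := by
    have := F.deviation_smul_right ν φ 0 0
    rw [zero_smul, zero_smul] at this
    rw [this]
    exact CesaroNull.zero
  have hunion : ∀ s t : Set Y, MeasurableSet s → MeasurableSet t → Disjoint s t →
      CesaroNull (F.deviation ν φ (s.indicator fun _ => 1)) →
      CesaroNull (F.deviation ν φ (t.indicator fun _ => 1)) →
      CesaroNull (F.deviation ν φ ((s ∪ t).indicator fun _ => 1)) := by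
    intro s t hs ht hd h₁ h₂
    rw [indicator_union_of_disjoint hd]
    exact (h.deviation_add_right φ (integrable_indicator_one hs) (integrable_indicator_one ht)) ▸
      h₁.add h₂
  induction s, hs using MeasurableSpace.induction_on_inter hgen hpi with
  | empty =>
    rw [indicator_empty]
    exact hzero
  | basic s hs => exact hC s hs
  | compl s hs ih =>
    have heq : (sᶜ.indicator fun _ => (1 : ℝ)) =
        (univ.indicator fun _ => (1 : ℝ)) - s.indicator fun _ => (1 : ℝ) := by
      rw [indicator_univ, indicator_compl]
    rw [heq, h.deviation_sub_right φ (integrable_indicator_one MeasurableSet.univ)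
      (integrable_indicator_one hs), sub_eq_add_neg, ← neg_one_smul ℝ]
    exact (hC univ huniv).add (ih.smul (-1))
  | iUnion f hd hf ih =>
    have hacc : ∀ n, MeasurableSet (accumulate f n) := fun n =>
      MeasurableSet.biUnion (to_countable _) fun i _ => hf i
    have hnull : ∀ n, CesaroNull (F.deviation ν φ ((accumulate f n).indicator fun _ => 1)) := by
      intro n
      induction n with
      | zero =>
        rw [accumulate_zero_nat]
        exact ih 0
      | succ n ihn =>
        rw [accumulate_succ]
        exact hunion _ _ (hacc n) (hf _) (disjoint_accumulate hd (Nat.lt_succ_self n)) ihn (ih _)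
    -- The finite unions converge to the whole union in `L¹`, by continuity of the measure from
    -- below.
    refine h.cesaroNull_of_forall_exists_right φ
      (integrable_indicator_one (MeasurableSet.iUnion hf)) fun ε hε => ?_
    have hlim : Tendsto (fun n => ν.real (accumulate f n)) atTop (𝓝 (ν.real (⋃ i, f i))) :=
      (ENNReal.tendsto_toReal (measure_ne_top ν _)).comp tendsto_measure_iUnion_accumulate
    obtain ⟨n, hn⟩ := (hlim.eventually (lt_mem_nhds (sub_lt_self _ hε))).exists
    refine ⟨_, integrable_indicator_one (hacc n), hnull n, ?_⟩
    have hsub : accumulate f n ⊆ ⋃ i, f i := accumulate_subset_iUnion n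
    have heq : (fun z => ‖(⋃ i, f i).indicator (fun _ => (1 : ℝ)) z -
        (accumulate f n).indicator (fun _ => (1 : ℝ)) z‖) =
        ((⋃ i, f i) \ accumulate f n).indicator 1 := by
      ext z
      by_cases hz : z ∈ accumulate f n
      · simp [hz, hsub hz]
      · by_cases hz' : z ∈ ⋃ i, f i <;> simp only [indicator, hz, hz', Set.mem_sdiff] <;> simp
    rw [heq, integral_indicator_one ((MeasurableSet.iUnion hf).diff (hacc n)),
      measureReal_sdiff hsub (hacc n)]
    linarith

/-- A null deviation from the indicators of measurable sets gives null deviations from all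
integrable functions. -/
theorem CorrCycle.IsKoopmanContraction.cesaroNull_of_indicator [IsProbabilityMeasure ν]
    (h : F.IsKoopmanContraction ν) (φ : C(Y, ℝ))
    (hind : ∀ s, MeasurableSet s → CesaroNull (F.deviation ν φ (s.indicator fun _ => 1)))
    {ψ : Y → ℝ} (hψ : Integrable ψ ν) : CesaroNull (F.deviation ν φ ψ) := by
  refine Integrable.induction (fun ψ => CesaroNull (F.deviation ν φ ψ)) ?_ ?_ ?_ ?_ hψ
  · intro c s hs _
    have heq : (s.indicator fun _ => c) = c • s.indicator fun _ => (1 : ℝ) := by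
      ext z
      by_cases hz : z ∈ s <;> simp [hz]
    rw [heq, CorrCycle.deviation_smul_right]
    exact (hind s hs).smul c
  · intro f g _ hf hg hf' hg'
    rw [h.deviation_add_right φ hf hg]
    exact hf'.add hg'
  · refine isClosed_of_closure_subset fun f hf => ?_
    refine h.cesaroNull_of_forall_exists_right φ (L1.integrable_coeFn f) fun ε hε => ?_
    obtain ⟨g, hg, hfg⟩ := Metric.mem_closure_iff.1 hf ε hε
    refine ⟨g, L1.integrable_coeFn g, hg, ?_⟩
    rw [L1.dist_eq_integral_dist] at hfg
    simpa only [dist_eq_norm] using hfg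
  · intro f g hfg _ hf
    exact F.deviation_congr_right hfg ▸ hf

variable [OpensMeasurableSpace Y] [IsProbabilityMeasure ν]

theorem integrable_of_continuousMap (φ : C(Y, ℝ)) : Integrable φ ν :=
  φ.continuous.integrable_of_hasCompactSupport (HasCompactSupport.of_compactSpace _)

theorem CorrCycle.IsKoopmanContraction.deviation_add_left (h : F.IsKoopmanContraction ν)
    (hF : F.IsClosedFinite) (φ φ' : C(Y, ℝ)) {ψ : Y → ℝ} (hψ : Integrable ψ ν) :
    F.deviation ν (φ + φ' : C(Y, ℝ)) ψ = F.deviation ν φ ψ + F.deviation ν φ' ψ := by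
  ext j
  have h₁ := h.integrable_mul j φ hψ
  have h₂ := h.integrable_mul j φ' hψ
  simp only [CorrCycle.deviation, CorrCycle.correlation, Pi.add_apply, ContinuousMap.coe_add,
    hF.iterate_koopman, map_add, add_mul] at h₁ h₂ ⊢
  rw [integral_add h₁ h₂, integral_add (integrable_of_continuousMap φ)
    (integrable_of_continuousMap φ')]
  ring

theorem CorrCycle.IsClosedFinite.deviation_smul_left {Y : Type*} [TopologicalSpace Y]
    [MeasurableSpace Y] {F : CorrCycle Y} (hF : F.IsClosedFinite) {ν : Measure Y} (c : ℝ)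
    (φ : C(Y, ℝ)) (ψ : Y → ℝ) :
    F.deviation ν (c • φ : C(Y, ℝ)) ψ = c • F.deviation ν φ ψ := by
  ext j
  simp only [CorrCycle.deviation, CorrCycle.correlation, Pi.smul_apply, ContinuousMap.coe_smul,
    hF.iterate_koopman, map_smul, smul_eq_mul, mul_assoc, integral_const_mul]
  ring

theorem CorrCycle.IsKoopmanContraction.deviation_sub_left (h : F.IsKoopmanContraction ν)
    (hF : F.IsClosedFinite) (φ φ' : C(Y, ℝ)) {ψ : Y → ℝ} (hψ : Integrable ψ ν) :
    F.deviation ν (φ - φ' : C(Y, ℝ)) ψ = F.deviation ν φ ψ - F.deviation ν φ' ψ := by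
  have := h.deviation_add_left hF φ ((-1 : ℝ) • φ') hψ
  rw [hF.deviation_smul_left] at this
  simpa [sub_eq_add_neg] using this

/-- The `φ` with null deviation from a given `ψ` form a closed subspace. -/
theorem CorrCycle.IsKoopmanContraction.cesaroNull_of_span_dense (h : F.IsKoopmanContraction ν)
    (hF : F.IsClosedFinite) {P : Set C(Y, ℝ)}
    (hP : (Submodule.span ℝ P).topologicalClosure = ⊤) {ψ : Y → ℝ} (hψ : Integrable ψ ν)
    (hnull : ∀ φ ∈ P, CesaroNull (F.deviation ν φ ψ)) (φ : C(Y, ℝ)) :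
    CesaroNull (F.deviation ν φ ψ) := by
  have hspan : ∀ φ ∈ Submodule.span ℝ P, CesaroNull (F.deviation ν φ ψ) := by
    intro φ hφ
    induction hφ using Submodule.span_induction with
    | mem φ hφ => exact hnull φ hφ
    | zero =>
      have := hF.deviation_smul_left (ν := ν) 0 0 ψ
      rw [zero_smul, zero_smul] at this
      rw [this]
      exact CesaroNull.zero
    | add φ φ' _ _ hφ hφ' =>
      rw [h.deviation_add_left hF φ φ' hψ]
      exact hφ.add hφ'
    | smul c φ _ hφ =>
      rw [hF.deviation_smul_left]
      exact hφ.smul c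
  refine CesaroNull.of_forall_exists fun ε hε => ?_
  have hmem : φ ∈ closure (Submodule.span ℝ P : Set C(Y, ℝ)) := by
    rw [← Submodule.topologicalClosure_coe, hP]
    trivial
  have hI : 0 ≤ ∫ z, ‖ψ z‖ ∂ν := integral_nonneg fun _ => norm_nonneg _
  obtain ⟨φ', hφ', hd⟩ := Metric.mem_closure_iff.1 hmem (ε / (2 * ∫ z, ‖ψ z‖ ∂ν + 1))
    (by positivity)
  refine ⟨_, hspan φ' hφ', fun j => ?_⟩
  rw [← Pi.sub_apply, ← h.deviation_sub_left hF φ φ' hψ]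
  refine (h.abs_deviation_le _ hψ j).trans ?_
  rw [dist_eq_norm, lt_div_iff₀ (by positivity)] at hd
  nlinarith [norm_nonneg (φ - φ')]

end Density

/-- The sums of products of functions of one variable are dense among the continuous functions. -/
theorem span_P₁_topologicalClosure (X : Type*) [TopologicalSpace X] [CompactSpace X] [T2Space X] :
    (Submodule.span ℝ (P₁ X)).topologicalClosure = ⊤ := by
  let S : Submonoid C(X × X, ℝ) :=
    { carrier := P₁ X
      one_mem' := ⟨1, 1, fun _ => by simp⟩
      mul_mem' := by
        rintro φ φ' ⟨a, b, h⟩ ⟨a', b', h'⟩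
        exact ⟨a * a', b * b', fun x => by
          simp only [ContinuousMap.mul_apply, h, h']
          ring⟩ }
  -- `P₁ X` is already a submonoid, so its span is an algebra and Stone–Weierstrass applies to it.
  have hspan : Subalgebra.toSubmodule (Algebra.adjoin ℝ (P₁ X)) = Submodule.span ℝ (P₁ X) := by
    rw [Algebra.adjoin_eq_span]
    have hS : Submonoid.closure (P₁ X) = S := S.closure_eq
    rw [hS]
    rfl
  have hsep : (Algebra.adjoin ℝ (P₁ X)).SeparatesPoints := by
    intro x y hxy
    have hmem : ∀ φ₁ φ₂ : C(X, ℝ), (φ₁.comp .fst * φ₂.comp .snd : C(X × X, ℝ)) ∈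
        Algebra.adjoin ℝ (P₁ X) := fun φ₁ φ₂ =>
      Algebra.subset_adjoin ⟨φ₁, φ₂, fun _ => rfl⟩
    have hX : ∀ {a b : X}, a ≠ b → ∃ φ : C(X, ℝ), φ a ≠ φ b := by
      intro a b hab
      obtain ⟨f, hfa, hfb, -⟩ := exists_continuous_zero_one_of_isClosed
        (isClosed_singleton (x := a)) (isClosed_singleton (x := b)) (by simpa using hab)
      refine ⟨f, ?_⟩
      rw [hfa rfl, hfb rfl]
      simp
    by_cases h1 : x.1 = y.1
    · have h2 : x.2 ≠ y.2 := fun h2 => hxy (Prod.ext h1 h2)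
      obtain ⟨φ, hφ⟩ := hX h2
      exact ⟨_, ⟨_, hmem 1 φ, rfl⟩, by simpa using hφ⟩
    · obtain ⟨φ, hφ⟩ := hX h1
      exact ⟨_, ⟨_, hmem φ 1, rfl⟩, by simpa using hφ⟩
  have htop := ContinuousMap.subalgebra_topologicalClosure_eq_top_of_separatesPoints _ hsep
  rw [← hspan]
  refine SetLike.coe_injective ?_
  simpa using congrArg (fun A : Subalgebra ℝ C(X × X, ℝ) => (A : Set C(X × X, ℝ))) htop

theorem IsHolomorphicCorrespondence.isClosedFinite {E : Type*} [NormedAddCommGroup E]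
    [NormedSpace ℂ E] {H : Type*} [TopologicalSpace H] {I : ModelWithCorners ℂ E H}
    {X : Type*} [TopologicalSpace X] [ChartedSpace H X] {F : CorrCycle X}
    (hF : IsHolomorphicCorrespondence I F) : F.IsClosedFinite where
  closed j := (hF.analytic j).isClosed
  finite := hF.finite_preimages

end HolCorr

theorem lemma6 {k : ℕ} {X : Type*} [TopologicalSpace X] [T2Space X] [CompactSpace X]
    [ConnectedSpace X] [ChartedSpace (EuclideanSpace ℂ (Fin k)) X]
    [IsManifold 𝓘(ℂ, EuclideanSpace ℂ (Fin k)) ω X]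
    [MeasurableSpace X] [BorelSpace X]
    (F : HolCorr.CorrCycle X)
    (hF : HolCorr.IsHolomorphicCorrespondence 𝓘(ℂ, EuclideanSpace ℂ (Fin k)) F)
    (μ : Measure X) [IsProbabilityMeasure μ] (hμ : F.IsPullbackInvariant μ) :
    (F.prod F).WeaklyMixing (μ.prod μ) ↔
      ∀ φ ∈ HolCorr.P₁ X, ∀ ψ ∈ HolCorr.P₂ X,
        Tendsto (fun n : ℕ => 1 / (n : ℝ) * ∑ j ∈ Finset.range n,
          |(F.prod F).correlation (μ.prod μ) j φ ψ
            - (∫ z, φ z ∂(μ.prod μ)) * ∫ z, ψ z ∂(μ.prod μ)|) atTop (𝓝 0) := by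
  have : SecondCountableTopology X :=
    ChartedSpace.secondCountable_of_sigmaCompact (EuclideanSpace ℂ (Fin k)) X
  constructor
  · rintro h φ - _ ⟨B₁, B₂, hB₁, hB₂, rfl⟩
    exact h φ _ (HolCorr.integrable_indicator_one (hB₁.prod hB₂))
  intro h
  have hcf := hF.isClosedFinite
  have hcontr : (F.prod F).IsKoopmanContraction (μ.prod μ) := by
    by_cases hd : (F.prod F).topDegree = 0
    · exact HolCorr.CorrCycle.isKoopmanContraction_of_topDegree_eq_zero hd
    · have hd' : F.topDegree ≠ 0 := fun h0 => hd (by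
        rw [HolCorr.CorrCycle.topDegree_prod_self F hd, h0])
      obtain ⟨κ, hκ, hinv, hae⟩ := hμ.exists_isMarkovKernel hcf hF.coeff_pos hd'
      exact (hcf.actsAsMarkovKernel_prod hd hinv hae).isKoopmanContraction
  intro φ ψ hψ
  -- With `φ` fixed, `ψ` is reduced to indicators and then to rectangles; only then is `φ` reduced
  -- to `P₁ X`.
  refine hcontr.cesaroNull_of_indicator φ (fun s hs => ?_) hψ
  refine hcontr.cesaroNull_indicator φ generateFrom_prod.symm isPiSystem_prod
    ⟨univ, MeasurableSet.univ, univ, MeasurableSet.univ, univ_prod_univ⟩ ?_ hs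
  rintro _ ⟨B₁, hB₁, B₂, hB₂, rfl⟩
  exact hcontr.cesaroNull_of_span_dense hcf.prod (HolCorr.span_P₁_topologicalClosure X)
    (HolCorr.integrable_indicator_one (hB₁.prod hB₂))
    (fun φ' hφ' => h φ' hφ' _ ⟨B₁, B₂, hB₁, hB₂, rfl⟩) φ
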